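/- \textbf{Setting.} Let $d\ge 2$ and $\kappa\in(0,1/(4d)]$. Let $\Omega$ be the set of environments $\omega=(\omega(x,e))_{x,e\in\mathbb Z^d,\,|e|_1=1}$ such that for every $x$ one has $\sum_{e}\omega(x,e)=1$ and $\omega(x,e)\ge 2\kappa$ for all $e$, with the product $\sigma$-algebra, and let $\mathbb P$ be a probability measure on $\Omega$ that is stationary, i.e. invariant under all translations of $\mathbb Z^d$. Let $P_{x,\omega}$ be the law of the Markov chain $(X_n)_{n\ge0}$ on $\mathbb Z^d$ with $X_0=x$ that jumps from $y$ to $y+e$ with probability $\omega(y,e)$, and let $P_x=\mathbb P\otimes P_{x,\omega}$ be the annealed law. Write $x\cdot y$ for the Euclidean scalar product and $|x|_2$ for the Euclidean norm. For $u\in\mathbb R^d$ and $a\in\mathbb R$ put $T^u_a=\inf\{n\ge0: X_n\cdot u\ge a\}$ and $\widetilde T^u_a=T^{-u}_{-a}=\inf\{n\ge 0:X_n\cdot u\le a\}$ (with $\inf\emptyset=\infty$). For $A\subset\mathbb Z^d$ put $T_A=\inf\{n\ge0:X_n\notin A\}$ and $\partial A=\{z\in\mathbb Z^d\setminus A:\exists\,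 y\in A,\ |z-y|_1\le 1\}$. The event $\{X_{T_A}\notin F\}$ includes $\{T_A=\infty\}$. All limits $M\to\infty$ are over real $M$, and $\log 0=-\infty$. Let $l_0$ be a unit vector of $\mathbb R^d$ and let $R$ be any rotation (or, more generally, any linear isometry) of $\mathbb R^d$ with $R(e_1)=l_0$. For $L,L'>0$ put $B_{L,L',l_0}=R\big((-L,L)\times(-L',L')^{d-1}\big)\cap\mathbb Z^d$ and $\partial^+B_{L,L',l_0}=\partial B_{L,L',l_0}\cap\{y: y\cdot l_0\ge L\}$. Unit vectors $l_0,l_1,\dots,l_k$ and numbers $a_0=1$, $a_1,\dots,a_k>0$, $b_0,\dots,b_k>0$ are said to \emph{generate an $l_0$-directed system of slabs of order $1$} if (a) $l_0,\dots,l_k$ span $\mathbb R^d$; (b) $\{x\in\mathbb R^d: x\cdot l_0\in[-b_0,1],\ x\cdot l_i\ge -b_i \text{ for } 1\le i\le k\}\subset\{x\in\mathbb R^d: x\cdot l_i<a_i \text{ for } 1\le i\le k\}$; (c) $\limsup_{M\to\infty}M^{-1}\log P_0\big[\widetilde T^{l_i}_{-b_iM}<T^{l_i}_{a_iM}\big]<0$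 for every $0\le i\le k$. \textbf{Lemma.} The following assertions are equivalent: (i) There exist $k$, unit vectors $l_1,\dots,l_k$ and numbers $a_0=1$, $a_1,\dots,a_k>0$, $b_0,\dots,b_k>0$ that, together with $l_0$, generate an $l_0$-directed system of slabs of order $1$. (ii) There are constants $b,\hat r>0$ and, for all large $M$, finite sets $\Delta_M\subset\mathbb Z^d$ with $0\in\Delta_M\subset\{x: x\cdot l_0\ge -bM\}\cap\{x:|x|_2\le\hat rM\}$ such that $$\limsup_{M\to\infty}M^{-1}\log P_0\big[X_{T_{\Delta_M}}\notin\partial^+\Delta_M\big]<0,\qquad \partial^+\Delta_M=\partial\Delta_M\cap\{x: x\cdot l_0\ge M\}.$$ (iii) There is $\mathfrak r>0$ such that $$\limsup_{M\to\infty}M^{-1}\log P_0\big[X_{T_{B_{M,\mathfrak rM,l_0}}}\notin\partial^+B_{M,\mathfrak rM,l_0}\big]<0.$$ -/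

import Mathlib

open MeasureTheory ProbabilityTheory Filter Topology Set

noncomputable section

namespace RWRE

/-! ### The lattice and the environments -/

/-- The lattice `ℤ^d`. -/
abbrev Site (d : ℕ) : Type := Fin d → ℤ

/-- The space `ℝ^d` with its Euclidean structure. -/
abbrev Space (d : ℕ) : Type := EuclideanSpace ℝ (Fin d)

/-- A lattice point as a point of `ℝ^d`. -/
def Site.toSpace {d : ℕ} (x : Site d) : Space d := WithLp.toLp 2 fun i => (x i : ℝ)

/-- The `2d` nearest-neighbour directions: `(i, true)` stands for `e_i`, `(i, false)` for `-e_i`. -/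
abbrev Dir (d : ℕ) : Type := Fin d × Bool

/-- The lattice vector of a direction. -/
def Dir.vec {d : ℕ} (e : Dir d) : Site d := Pi.single e.1 (if e.2 then 1 else -1)

/-- The probability vectors on the `2d` directions with all weights at least `2κ`. -/
abbrev JumpLaw (d : ℕ) (κ : ℝ) : Type :=
  {z : Dir d → ℝ // z ∈ stdSimplex ℝ (Dir d) ∧ ∀ e, 2 * κ ≤ z e}

/-- Environments, with the product `σ`-algebra; `ω x` is the jump law at the site `x`. -/
abbrev Env (d : ℕ) (κ : ℝ) : Type := Site d → JumpLaw d κ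

/-- Invariance of the law of the environment under all lattice translations. -/
def IsStationary {d : ℕ} {κ : ℝ} (P : Measure (Env d κ)) : Prop :=
  ∀ z : Site d, P.map (fun ω x => ω (x + z)) = P

/-! ### Quenched and annealed laws -/

/-- The law of `x + e` when the direction `e` is chosen with probability `ω(x, e)`. -/
def stepLaw {d : ℕ} {κ : ℝ} (ω : Env d κ) (x : Site d) : Measure (Site d) :=
  ∑ e : Dir d, ENNReal.ofReal ((ω x).1 e) • Measure.dirac (x + e.vec)

instance {d : ℕ} {κ : ℝ} (ω : Env d κ) (x : Site d) : IsProbabilityMeasure (stepLaw ω x) := by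
  constructor
  simp only [stepLaw, Measure.finsetSum_apply, Measure.smul_apply, measure_univ, smul_eq_mul,
    mul_one]
  rw [← ENNReal.ofReal_sum_of_nonneg fun e _ => (ω x).2.1.1 e, (ω x).2.1.2, ENNReal.ofReal_one]

/-- The transition kernel of the walk in the environment `ω`: given the path up to time `n`, the
next position has law `stepLaw ω (X_n)`. -/
def pathKernel {d : ℕ} {κ : ℝ} (ω : Env d κ) (n : ℕ) :
    Kernel ((_ : Finset.Iic n) → Site d) (Site d) where
  toFun h := stepLaw ω (h ⟨n, Finset.mem_Iic.2 le_rfl⟩)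
  measurable' := (measurable_of_countable (stepLaw ω)).comp (measurable_pi_apply _)

instance {d : ℕ} {κ : ℝ} (ω : Env d κ) (n : ℕ) : IsMarkovKernel (pathKernel ω n) :=
  ⟨fun h => inferInstanceAs (IsProbabilityMeasure (stepLaw ω (h ⟨n, Finset.mem_Iic.2 le_rfl⟩)))⟩

/-- The quenched law `P_{x,ω}` of the walk started at `x`, on the path space `(ℤ^d)^ℕ`. -/
def quenched {d : ℕ} {κ : ℝ} (x : Site d) (ω : Env d κ) : Measure (ℕ → Site d) :=
  Kernel.trajMeasure (X := fun _ => Site d) (Measure.dirac x) (pathKernel ω)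

instance {d : ℕ} {κ : ℝ} (x : Site d) (ω : Env d κ) : IsProbabilityMeasure (quenched x ω) := by
  unfold quenched; infer_instance

theorem stepLaw_singleton {d : ℕ} {κ : ℝ} (ω : Env d κ) (x y : Site d) :
    stepLaw ω x {y} = ∑ e : Dir d, if x + e.vec = y then ENNReal.ofReal ((ω x).1 e) else 0 := by
  simp only [stepLaw, Measure.finsetSum_apply, Measure.smul_apply, smul_eq_mul,
    Measure.dirac_apply, Set.indicator_apply, Set.mem_singleton_iff, Pi.one_apply, mul_ite,
    mul_one, mul_zero]

theorem setOf_path_eq {d : ℕ} (y : ℕ → Site d) (n : ℕ) :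
    {w : ℕ → Site d | ∀ i ≤ n, w i = y i} = (Preorder.frestrictLe (π := fun _ => Site d) n) ⁻¹'
      ({fun i : Finset.Iic n => y i} : Set (Finset.Iic n → Site d)) := by
  ext w
  constructor
  · intro h
    exact funext fun i => h i (Finset.mem_Iic.1 i.2)
  · intro h i hi
    exact congrFun (show _ = _ from h) (⟨i, Finset.mem_Iic.2 hi⟩ : Finset.Iic n)

/-- The finite-dimensional distributions of the walk: it is the Markov chain started at `x` with
transition probabilities `ω`. -/
theorem quenched_path {d : ℕ} {κ : ℝ} (x : Site d) (ω : Env d κ) (y : ℕ → Site d) (n : ℕ) :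
    quenched x ω {w | ∀ i ≤ n, w i = y i} =
      (if x = y 0 then 1 else 0) * ∏ i ∈ Finset.range n, stepLaw ω (y i) {y (i + 1)} := by
  induction n with
  | zero =>
    rw [setOf_path_eq, ← Measure.map_apply (by fun_prop) (measurableSet_singleton _), quenched,
      Kernel.trajMeasure, Measure.map_comp _ _ (by fun_prop), Kernel.traj_map_frestrictLe,
      Kernel.partialTraj_self, Measure.id_comp, Measure.map_apply (MeasurableEquiv.measurable _)
      (measurableSet_singleton _), Measure.dirac_apply]
    rw [Finset.range_zero, Finset.prod_empty, mul_one]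
    split_ifs with h
    · refine Set.indicator_of_mem ?_ _
      refine funext fun ⟨i, hi⟩ => ?_
      obtain rfl : i = 0 := by simpa using hi
      exact h
    · refine Set.indicator_of_notMem (fun hx => h ?_) _
      exact congrFun (show _ = _ from hx) (⟨0, by simp⟩ : Finset.Iic 0)
  | succ n ih =>
    have key := Kernel.map_frestrictLe_trajMeasure_compProd_eq_map_trajMeasure
      (X := fun _ => Site d) (μ₀ := Measure.dirac x) (κ := pathKernel ω) (a := n)
    have h1 : {w : ℕ → Site d | ∀ i ≤ n + 1, w i = y i} =
        (fun w => (Preorder.frestrictLe (π := fun _ => Site d) n w, w (n + 1))) ⁻¹'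
          (({fun i : Finset.Iic n => y i} : Set (Finset.Iic n → Site d)) ×ˢ {y (n + 1)}) := by
      ext w
      have := Set.ext_iff.1 (setOf_path_eq y n) w
      constructor
      · exact fun h => ⟨this.1 fun i hi => h i (by omega), h _ le_rfl⟩
      · rintro ⟨h, h'⟩ i hi
        rcases Nat.lt_or_ge n i with hlt | hle
        · obtain rfl : i = n + 1 := by omega
          exact h'
        · exact this.2 h i hle
    rw [h1, quenched, ← Measure.map_apply (by fun_prop)
      ((measurableSet_singleton _).prod (measurableSet_singleton _)), ← key,
      Measure.compProd_apply_prod (measurableSet_singleton _) (measurableSet_singleton _),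
      lintegral_singleton, Measure.map_apply (by fun_prop) (measurableSet_singleton _),
      ← setOf_path_eq y n, ← quenched, ih, Finset.prod_range_succ, mul_comm, mul_assoc]
    rfl

theorem measurable_quenched {d : ℕ} {κ : ℝ} (x : Site d) :
    Measurable (quenched x : Env d κ → Measure (ℕ → Site d)) := by
  have hstep : ∀ a b : Site d, Measurable fun ω : Env d κ => stepLaw ω a {b} := by
    intro a b
    simp only [stepLaw_singleton]
    refine Finset.measurable_sum _ fun e _ => ?_
    split_ifs
    · exact ((measurable_pi_apply e).comp
        (measurable_subtype_coe.comp (measurable_pi_apply a))).ennreal_ofReal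
    · exact measurable_const
  have hpath : ∀ (n : ℕ) (y : ℕ → Site d),
      Measurable fun ω : Env d κ => quenched x ω {w | ∀ i ≤ n, w i = y i} := by
    intro n y
    simp only [quenched_path]
    exact (Finset.measurable_prod _ fun i _ => hstep _ _).const_mul _
  refine Measurable.measure_of_isPiSystem_of_isProbabilityMeasure
    (generateFrom_measurableCylinders (α := fun _ : ℕ => Site d)).symm
    (isPiSystem_measurableCylinders (α := fun _ : ℕ => Site d)) ?_
  intro s hs
  obtain ⟨I, S, hS, rfl⟩ := (mem_measurableCylinders _).1 hs
  obtain ⟨n, hn⟩ : ∃ n, I ⊆ Finset.Iic n :=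
    ⟨I.sup id, fun i hi => Finset.mem_Iic.2 (Finset.le_sup (f := id) hi)⟩
  let T : Set (Finset.Iic n → Site d) := {h | (fun i : I => h ⟨i, hn i.2⟩) ∈ S}
  have hcyl : (cylinder I S : Set (ℕ → Site d)) =
      ⋃ h ∈ T, (Preorder.frestrictLe (π := fun _ => Site d) n) ⁻¹' {h} := by
    ext w
    simp only [Set.mem_iUnion, exists_prop]
    constructor
    · exact fun h => ⟨Preorder.frestrictLe (π := fun _ => Site d) n w, h, rfl⟩
    · rintro ⟨h, hh, rfl⟩
      exact hh
  have hmeas : ∀ ω : Env d κ, quenched x ω (cylinder I S) =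
      ∑' h : T, quenched x ω ((Preorder.frestrictLe (π := fun _ => Site d) n) ⁻¹' {h.1}) := by
    intro ω
    rw [hcyl]
    refine measure_biUnion T.to_countable ?_ fun h _ =>
      (measurableSet_singleton h).preimage (by fun_prop)
    intro h _ h' _ hne
    exact Set.disjoint_left.2 fun w hw hw' => hne (hw.symm.trans hw')
  simp only [hmeas]
  refine Measurable.tsum fun h => ?_
  have := hpath n fun i => if hi : i ∈ Finset.Iic n then h.1 ⟨i, hi⟩ else 0
  rw [setOf_path_eq] at this
  have e : (fun i : Finset.Iic n => if hi : (i : ℕ) ∈ Finset.Iic n then h.1 ⟨i, hi⟩ else 0) = h.1 :=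
    funext fun i => dif_pos i.2
  rwa [e] at this

/-- The quenched laws as a kernel from environments to paths. -/
def quenchedKernel (d : ℕ) (κ : ℝ) (x : Site d) : Kernel (Env d κ) (ℕ → Site d) :=
  ⟨quenched x, measurable_quenched x⟩

instance (d : ℕ) (κ : ℝ) (x : Site d) : IsMarkovKernel (quenchedKernel d κ x) :=
  ⟨fun ω => inferInstanceAs (IsProbabilityMeasure (quenched x ω))⟩

/-- The annealed law `P_x`: the semidirect product of the law of the environment and the quenched
laws, on pairs (environment, path). -/
def annealed {d : ℕ} {κ : ℝ} (P : Measure (Env d κ)) (x : Site d) :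
    Measure (Env d κ × (ℕ → Site d)) :=
  P ⊗ₘ quenchedKernel d κ x

/-- The annealed probability `P_x[A]` of an event `A` of the path. -/
def annealedProb {d : ℕ} {κ : ℝ} (P : Measure (Env d κ)) (x : Site d) (A : Set (ℕ → Site d)) :
    ENNReal :=
  annealed P x {p | p.2 ∈ A}

/-! ### Stopping times, boundaries, boxes -/

/-- The first time `n` at which the path `w` is in `A`, and `⊤` if there is none. -/
def hitTime {d : ℕ} (A : Set (Site d)) (w : ℕ → Site d) : ℕ∞ :=
  ⨅ (n : ℕ) (_ : w n ∈ A), (n : ℕ∞)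

/-- The exit time `T_A`. -/
def exitTime {d : ℕ} (A : Set (Site d)) (w : ℕ → Site d) : ℕ∞ := hitTime Aᶜ w

/-- `T^u_a`, the first time at which `X_n · u ≥ a`. -/
def timeAbove {d : ℕ} (u : Space d) (a : ℝ) (w : ℕ → Site d) : ℕ∞ :=
  hitTime {x | a ≤ inner ℝ x.toSpace u} w

/-- `T̃^u_a = T^{-u}_{-a}`, the first time at which `X_n · u ≤ a`. -/
def timeBelow {d : ℕ} (u : Space d) (a : ℝ) (w : ℕ → Site d) : ℕ∞ := timeAbove (-u) (-a) w

/-- The boundary `∂A`: the sites outside `A` at `ℓ¹`-distance at most one from a site of `A`. -/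
def boundary {d : ℕ} (A : Set (Site d)) : Set (Site d) :=
  {z | z ∉ A ∧ ∃ y ∈ A, ∑ i, |z i - y i| ≤ 1}

/-- The positive boundary `∂A ∩ {x : x · l ≥ M}`. -/
def posBoundary {d : ℕ} (A : Set (Site d)) (l : Space d) (M : ℝ) : Set (Site d) :=
  boundary A ∩ {x | M ≤ inner ℝ x.toSpace l}

/-- The event `X_{T_A} ∉ F` that the path does not leave `A` through `F` (paths that never leave
`A` are included). -/
def notExitThrough {d : ℕ} (A F : Set (Site d)) : Set (ℕ → Site d) :=
  {w | ¬ ∃ n : ℕ, exitTime A w = n ∧ w n ∈ F}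

/-- The box `R((-L, L) × (-L', L')^{d-1}) ∩ ℤ^d`. -/
def box {d : ℕ} (R : Space d ≃ₗᵢ[ℝ] Space d) (L L' : ℝ) : Set (Site d) :=
  {x | ∃ z : Space d, (∀ i : Fin d, |z i| < if (i : ℕ) = 0 then L else L') ∧ x.toSpace = R z}

/-! ### The three conditions -/

/-- `limsup_{M → ∞} M⁻¹ log p(M) < 0` over real `M`, with `log 0 = -∞`. -/
def ExpDecay (p : ℝ → ENNReal) : Prop :=
  limsup (fun M : ℝ => ((M⁻¹ : ℝ) : EReal) * ENNReal.log (p M)) atTop < 0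

/-- The data `l 0, …, l k`, `a 0 = 1, a 1, …, a k`, `b 0, …, b k` generate an `l 0`-directed system
of slabs of order `1`. -/
structure GeneratesSlabs {d : ℕ} {κ : ℝ} (P : Measure (Env d κ)) {k : ℕ}
    (l : Fin (k + 1) → Space d) (a b : Fin (k + 1) → ℝ) : Prop where
  norm_eq_one : ∀ i, ‖l i‖ = 1
  a_zero : a 0 = 1
  a_pos : ∀ i, 0 < a i
  b_pos : ∀ i, 0 < b i
  span_eq_top : Submodule.span ℝ (Set.range l) = ⊤
  subset_slabs :
    {x : Space d | inner ℝ x (l 0) ∈ Set.Icc (-b 0) 1 ∧ ∀ i ≠ 0, -b i ≤ inner ℝ x (l i)} ⊆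
      {x : Space d | ∀ i ≠ 0, inner ℝ x (l i) < a i}
  decay : ∀ i, ExpDecay fun M =>
    annealedProb P 0 {w | timeBelow (l i) (-b i * M) w < timeAbove (l i) (a i * M) w}

/-- There is an `l₀`-directed system of slabs of order `1`. -/
def HasSlabs {d : ℕ} {κ : ℝ} (P : Measure (Env d κ)) (l₀ : Space d) : Prop :=
  ∃ (k : ℕ) (l : Fin (k + 1) → Space d) (a b : Fin (k + 1) → ℝ),
    l 0 = l₀ ∧ GeneratesSlabs P l a b

/-- For all large `M` there are finite sets `Δ M`, containing `0` and contained in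
`{x · l₀ ≥ -bM} ∩ {|x|₂ ≤ rM}`, which the walk leaves other than through `∂⁺(Δ M)` with
exponentially small probability. -/
def HasExitSets {d : ℕ} {κ : ℝ} (P : Measure (Env d κ)) (l₀ : Space d) : Prop :=
  ∃ b r : ℝ, 0 < b ∧ 0 < r ∧ ∃ Δ : ℝ → Set (Site d),
    (∀ᶠ M in atTop, (Δ M).Finite ∧ 0 ∈ Δ M ∧
      Δ M ⊆ {x | -b * M ≤ inner ℝ x.toSpace l₀} ∩ {x | ‖x.toSpace‖ ≤ r * M}) ∧
    ExpDecay fun M => annealedProb P 0 (notExitThrough (Δ M) (posBoundary (Δ M) l₀ M))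

/-- For some `r > 0`, the walk leaves the box `R((-M, M) × (-rM, rM)^{d-1})` other than through its
positive boundary with exponentially small probability. -/
def HasBoxExit {d : ℕ} {κ : ℝ} (P : Measure (Env d κ)) (l₀ : Space d)
    (R : Space d ≃ₗᵢ[ℝ] Space d) : Prop :=
  ∃ r : ℝ, 0 < r ∧ ExpDecay fun M =>
    annealedProb P 0 (notExitThrough (box R M (r * M)) (posBoundary (box R M (r * M)) l₀ M))

end RWRE

end

/-!
All three conditions say that the walk escapes in the direction `l₀` up to exponentially small
probability, and each one is turned into the next.

* From slabs to exit sets (`HasSlabs.hasExitSets`): dilate by `M` the region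
  `{-b₀ < x · l₀ < 1, x · l_i > -b_i}`. The spanning condition makes it bounded, so the walk leaves it
  almost surely (`quenched_forall_mem_eq_zero`). If it does so other than through the front face, it
  reaches `{x · l_i ≤ -b_i M}` for some `i` before `{x · l_i ≥ a_i M}`.
* From exit sets to boxes (`HasExitSets.hasBoxExit`): the walk leaves `N` successive translates of
  `Δ (M / N)` through their positive boundaries, and has then climbed to level `M`, with a total
  lateral displacement of order `M`. Since `b M / N < M` for `N > b`, it has not left the box
  elsewhere.
* From boxes to slabs (`HasBoxExit.hasSlabs`): tilt `l₀` slightly in all coordinate directions of the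
  box. The front face of the box still lies at height at least `M / 2` in the tilted directions, and
  after ten successive exits the walk has gained much more than it could ever lose.

The last two steps use the same principle, `ExpDecay.climbs`: successive exits from translates of a
given set multiply the height reached, and the failure probability stays exponentially small. The
translates that matter start at polynomially many sites `z`; the strong Markov property at the first
visit to `z` (`quenched_firstVisit_le`) and the stationarity of the environment bound the probability
of a bad exit from the translate at `z` by that of a bad exit at the origin
(`annealedProb_firstVisit_le`). The combinatorial part is the statement `mem_climbs_of_exits` about
single paths.
-/

noncomputable section

namespace RWRE

/-! ### Exponential decay -/

theorem expDecay_iff {p : ℝ → ENNReal} :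
    ExpDecay p ↔ ∃ c : ℝ, 0 < c ∧ ∀ᶠ M in atTop, p M ≤ ENNReal.ofReal (Real.exp (-c * M)) := by
  have key : ∀ {M : ℝ} (_ : 0 < M) (c : ℝ),
      ((M⁻¹ : ℝ) : EReal) * ENNReal.log (p M) ≤ ((-c : ℝ) : EReal) ↔
        p M ≤ ENNReal.ofReal (Real.exp (-c * M)) := by
    intro M hM c
    rw [← ENNReal.log_le_log_iff (x := p M), ENNReal.log_ofReal_of_pos (Real.exp_pos _),
      Real.log_exp, EReal.coe_inv, ← EReal.div_eq_inv_mul,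
      EReal.div_le_iff_le_mul (by exact_mod_cast hM) (EReal.coe_ne_top M), EReal.coe_mul, mul_comm]
  constructor
  · intro h
    obtain ⟨q, hq, hq0⟩ := EReal.lt_iff_exists_real_btwn.1 h
    refine ⟨-q, by simpa using hq0, ?_⟩
    filter_upwards [eventually_lt_of_limsup_lt hq, eventually_gt_atTop 0] with M hM hM0
    exact (key hM0 (-q)).1 (by simpa using hM.le)
  · rintro ⟨c, hc, h⟩
    refine lt_of_le_of_lt (limsup_le_of_le (a := ((-c : ℝ) : EReal)) (by isBoundedDefault) ?_)
      (by exact_mod_cast neg_lt_zero.2 hc)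
    filter_upwards [h, eventually_gt_atTop 0] with M hM hM0
    exact (key hM0 c).2 hM

/-- Polynomial factors do not affect exponential decay. -/
theorem ExpDecay.of_eventually_le_pow_mul {p q : ℝ → ENNReal} (hq : ExpDecay q) {C : ℝ} {n : ℕ}
    (h : ∀ᶠ M in atTop, p M ≤ ENNReal.ofReal (C * M ^ n) * q M) : ExpDecay p := by
  obtain ⟨c, hc, hq⟩ := expDecay_iff.1 hq
  refine expDecay_iff.2 ⟨c / 2, half_pos hc, ?_⟩
  have h1 : ∀ᶠ M : ℝ in atTop, C * M ^ n ≤ Real.exp (c / 2 * M) := by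
    have := ((isLittleO_pow_exp_pos_mul_atTop n (half_pos hc)).const_mul_left C).bound one_pos
    filter_upwards [this] with M hM
    have := (le_abs_self _).trans hM
    simpa using this
  filter_upwards [h, hq, h1] with M h hq h1
  calc p M ≤ _ := h
    _ ≤ ENNReal.ofReal (Real.exp (c / 2 * M)) * ENNReal.ofReal (Real.exp (-c * M)) := by gcongr
    _ = _ := by
      rw [← ENNReal.ofReal_mul (Real.exp_pos _).le, ← Real.exp_add]
      congr 2; ring

theorem ExpDecay.mono {p q : ℝ → ENNReal} (hq : ExpDecay q) (h : ∀ᶠ M in atTop, p M ≤ q M) :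
    ExpDecay p :=
  hq.of_eventually_le_pow_mul (C := 1) (n := 0) (by simpa using h)

theorem ExpDecay.comp_mul {p : ℝ → ENNReal} (hp : ExpDecay p) {c : ℝ} (hc : 0 < c) :
    ExpDecay fun M => p (c * M) := by
  obtain ⟨a, ha, h⟩ := expDecay_iff.1 hp
  refine expDecay_iff.2 ⟨a * c, mul_pos ha hc, ?_⟩
  filter_upwards [(tendsto_id.const_mul_atTop hc).eventually h] with M hM
  simpa [mul_assoc] using hM

theorem ExpDecay.add {p q : ℝ → ENNReal} (hp : ExpDecay p) (hq : ExpDecay q) :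
    ExpDecay fun M => p M + q M := by
  obtain ⟨a, ha, hp⟩ := expDecay_iff.1 hp
  obtain ⟨b, hb, hq⟩ := expDecay_iff.1 hq
  have hexp : ExpDecay fun M => ENNReal.ofReal (Real.exp (-(min a b) * M)) :=
    expDecay_iff.2 ⟨_, lt_min ha hb, Eventually.of_forall fun _ => le_rfl⟩
  refine hexp.of_eventually_le_pow_mul (C := 2) (n := 0) ?_
  filter_upwards [hp, hq, eventually_ge_atTop 0] with M hp hq hM
  have h2 : ENNReal.ofReal (2 * M ^ 0) = 2 := by simp
  rw [h2, two_mul]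
  refine add_le_add (hp.trans ?_) (hq.trans ?_)
  · gcongr; exact min_le_left _ _
  · gcongr; exact min_le_right _ _

theorem ExpDecay.sum {ι : Type*} (s : Finset ι) {p : ι → ℝ → ENNReal}
    (hp : ∀ i ∈ s, ExpDecay (p i)) : ExpDecay fun M => ∑ i ∈ s, p i M := by
  classical
  induction s using Finset.induction_on with
  | empty => exact expDecay_iff.2 ⟨1, one_pos, by simp⟩
  | insert i s hi ih =>
    simp only [Finset.sum_insert hi]
    exact (hp i (by simp)).add (ih fun j hj => hp j (by simp [hj]))

/-! ### Hitting times -/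

section HittingTimes

variable {d : ℕ} {A : Set (Site d)} {w : ℕ → Site d}

theorem hitTime_le_iff {n : ℕ} : hitTime A w ≤ n ↔ ∃ m ≤ n, w m ∈ A := by
  constructor
  · intro h
    by_contra! hc
    have : ((n + 1 : ℕ) : ℕ∞) ≤ hitTime A w := by
      refine le_iInf₂ fun m hm => ?_
      have : ¬ m ≤ n := fun h' => hc m h' hm
      exact_mod_cast (by omega : n + 1 ≤ m)
    have := this.trans h
    norm_cast at this
    omega
  · rintro ⟨m, hmn, hm⟩
    exact (iInf₂_le m hm).trans (by exact_mod_cast hmn)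

theorem hitTime_eq_iff {n : ℕ} : hitTime A w = n ↔ w n ∈ A ∧ ∀ m < n, w m ∉ A := by
  constructor
  · intro h
    obtain ⟨m, hmn, hm⟩ := hitTime_le_iff.1 h.le
    have hlt : ∀ j < n, w j ∉ A := fun j hj hA => by
      have := hitTime_le_iff.2 ⟨j, le_rfl, hA⟩
      rw [h] at this
      norm_cast at this
      omega
    obtain rfl : m = n := le_antisymm hmn (not_lt.1 fun h' => hlt m h' hm)
    exact ⟨hm, hlt⟩
  · rintro ⟨hn, hlt⟩
    refine le_antisymm (hitTime_le_iff.2 ⟨n, le_rfl, hn⟩) (le_iInf₂ fun m hm => ?_)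
    exact_mod_cast not_lt.1 fun h => hlt m h hm

theorem exitTime_eq_iff {n : ℕ} : exitTime A w = n ↔ w n ∉ A ∧ ∀ m < n, w m ∈ A := by
  simp [exitTime, hitTime_eq_iff]

theorem mem_notExitThrough_iff {F : Set (Site d)} :
    w ∈ notExitThrough A F ↔ ∀ n, w n ∉ A → (∀ m < n, w m ∈ A) → w n ∉ F := by
  simp [notExitThrough, exitTime_eq_iff]

theorem measurableSet_eval_mem (n : ℕ) (S : Set (Site d)) :
    MeasurableSet {w : ℕ → Site d | w n ∈ S} :=
  measurable_pi_apply n S.to_countable.measurableSet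

theorem measurableSet_notExitThrough (A F : Set (Site d)) :
    MeasurableSet (notExitThrough A F) := by
  have : notExitThrough A F =
      ⋂ n : ℕ, {w | w n ∉ A → (∀ m < n, w m ∈ A) → w n ∉ F} := by
    ext w; simp [mem_notExitThrough_iff]
  rw [this]
  refine MeasurableSet.iInter fun n => (measurableSet_eval_mem n A).compl.imp
    (.imp ?_ (measurableSet_eval_mem n F).compl)
  simp only [Set.ofPred_forall]
  exact .iInter fun m => .iInter fun _ => measurableSet_eval_mem m A

theorem timeBelow_lt_timeAbove_iff {u : Space d} {a b : ℝ} :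
    timeBelow u a w < timeAbove u b w ↔
      ∃ n, inner ℝ (w n).toSpace u ≤ a ∧ ∀ m ≤ n, inner ℝ (w m).toSpace u < b := by
  have hset : {x : Site d | -a ≤ inner ℝ x.toSpace (-u)} = {x | inner ℝ x.toSpace u ≤ a} := by
    ext x; simp [inner_neg_right]
  unfold timeBelow timeAbove
  rw [hset]
  constructor
  · intro h
    obtain ⟨n, hn⟩ := ENat.ne_top_iff_exists.1 h.ne_top
    rw [← hn] at h
    refine ⟨n, (hitTime_eq_iff.1 hn.symm).1, fun m hm => ?_⟩
    by_contra! hc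
    exact h.not_ge (hitTime_le_iff.2 ⟨m, hm, hc⟩)
  · rintro ⟨n, hn, hlt⟩
    refine lt_of_le_of_lt (hitTime_le_iff.2 ⟨n, le_rfl, hn⟩) (lt_of_not_ge fun h => ?_)
    obtain ⟨m, hm, hb⟩ := hitTime_le_iff.1 h
    exact (hlt m hm).not_ge hb

end HittingTimes

/-! ### The Markov property of the quenched walk -/

section Markov

variable {d : ℕ} {κ : ℝ}

/-- Finite measures on the path space are determined by their values on the sets of paths with a
prescribed initial piece. -/
theorem ext_of_path {μ ν : Measure (ℕ → Site d)} [IsFiniteMeasure μ] [IsFiniteMeasure ν]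
    (h : ∀ (n : ℕ) (y : ℕ → Site d),
      μ {w | ∀ i ≤ n, w i = y i} = ν {w | ∀ i ≤ n, w i = y i}) : μ = ν := by
  have key : ∀ (I : Finset ℕ) (S : Set (I → Site d)), μ (cylinder I S) = ν (cylinder I S) := by
    intro I S
    obtain ⟨n, hn⟩ : ∃ n, I ⊆ Finset.Iic n :=
      ⟨I.sup id, fun i hi => Finset.mem_Iic.2 (Finset.le_sup (f := id) hi)⟩
    let T : Set (Finset.Iic n → Site d) := {h | (fun i : I => h ⟨i, hn i.2⟩) ∈ S}
    have hcyl : (cylinder I S : Set (ℕ → Site d)) =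
        ⋃ h ∈ T, (Preorder.frestrictLe (π := fun _ => Site d) n) ⁻¹' {h} := by
      ext w
      simp only [Set.mem_iUnion, exists_prop]
      constructor
      · exact fun h => ⟨Preorder.frestrictLe (π := fun _ => Site d) n w, h, rfl⟩
      · rintro ⟨h, hh, rfl⟩
        exact hh
    have hmeas : ∀ ρ : Measure (ℕ → Site d), ρ (cylinder I S) =
        ∑' h : T, ρ ((Preorder.frestrictLe (π := fun _ => Site d) n) ⁻¹' {h.1}) := by
      intro ρ
      rw [hcyl]
      refine measure_biUnion T.to_countable ?_ fun h _ =>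
        (measurableSet_singleton h).preimage (by fun_prop)
      intro h _ h' _ hne
      exact Set.disjoint_left.2 fun w hw hw' => hne (hw.symm.trans hw')
    rw [hmeas, hmeas]
    refine tsum_congr fun g => ?_
    have e : (fun i : Finset.Iic n => if hi : (i : ℕ) ∈ Finset.Iic n then g.1 ⟨i, hi⟩ else 0) =
        g.1 := funext fun i => dif_pos i.2
    have := h n fun i => if hi : i ∈ Finset.Iic n then g.1 ⟨i, hi⟩ else 0
    rwa [setOf_path_eq, e] at this
  refine ext_of_generate_finite _ (generateFrom_measurableCylinders (α := fun _ : ℕ => Site d)).symm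
    (isPiSystem_measurableCylinders (α := fun _ : ℕ => Site d)) ?_ ?_
  · intro s hs
    obtain ⟨I, S, -, rfl⟩ := (mem_measurableCylinders _).1 hs
    exact key I S
  · simpa [cylinder] using key ∅ Set.univ

theorem measurableSet_setOf_path (y : ℕ → Site d) (n : ℕ) :
    MeasurableSet {w : ℕ → Site d | ∀ i ≤ n, w i = y i} := by
  rw [setOf_path_eq]
  exact (measurableSet_singleton _).preimage (by fun_prop)

/-- The path that starts at `x` and goes on along `w`. -/
def consPath (x : Site d) (w : ℕ → Site d) : ℕ → Site d
  | 0 => x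
  | n + 1 => w n

@[simp] theorem consPath_zero (x : Site d) (w : ℕ → Site d) : consPath x w 0 = x := rfl

@[simp] theorem consPath_succ (x : Site d) (w : ℕ → Site d) (n : ℕ) :
    consPath x w (n + 1) = w n := rfl

theorem measurable_consPath (x : Site d) : Measurable (consPath x) := by
  refine measurable_pi_lambda _ fun n => ?_
  cases n with
  | zero => exact measurable_const
  | succ n => exact measurable_pi_apply n

/-- The Markov property at time one. -/
theorem quenched_eq_sum (x : Site d) (ω : Env d κ) :
    quenched x ω =
      ∑ e : Dir d, ENNReal.ofReal ((ω x).1 e) • (quenched (x + e.vec) ω).map (consPath x) := by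
  have hfin : IsFiniteMeasure (∑ e : Dir d,
      ENNReal.ofReal ((ω x).1 e) • (quenched (x + e.vec) ω).map (consPath x)) := by
    refine ⟨?_⟩
    simp only [Measure.finsetSum_apply, Measure.smul_apply, smul_eq_mul]
    refine ENNReal.sum_lt_top.2 fun e _ => ENNReal.mul_lt_top ENNReal.ofReal_lt_top ?_
    rw [Measure.map_apply (measurable_consPath x) .univ]
    exact measure_lt_top _ _
  refine ext_of_path fun n y => ?_
  simp only [Measure.finsetSum_apply, Measure.smul_apply, smul_eq_mul,
    Measure.map_apply (measurable_consPath x) (measurableSet_setOf_path y n)]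
  rw [quenched_path]
  by_cases hx : x = y 0
  swap
  · have : ∀ e : Dir d, (quenched (x + e.vec) ω)
        (consPath x ⁻¹' {w | ∀ i ≤ n, w i = y i}) = 0 := by
      intro e
      convert measure_empty (μ := quenched (x + e.vec) ω)
      ext w
      simp only [mem_preimage, mem_ofPred_eq, mem_empty_iff_false, iff_false]
      exact fun h => hx (h 0 (Nat.zero_le _))
    simp only [this, mul_zero, Finset.sum_const_zero, if_neg hx, zero_mul]
  cases n with
  | zero =>
    have : consPath x ⁻¹' {w | ∀ i ≤ 0, w i = y i} = univ := by
      ext w; simp [hx]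
    simp only [this, measure_univ, mul_one]
    rw [← ENNReal.ofReal_sum_of_nonneg fun e _ => (ω x).2.1.1 e, (ω x).2.1.2]
    simp [hx]
  | succ n =>
    have : consPath x ⁻¹' {w | ∀ i ≤ n + 1, w i = y i} = {w | ∀ i ≤ n, w i = y (i + 1)} := by
      ext w
      simp only [mem_preimage, mem_ofPred_eq]
      constructor
      · exact fun h i hi => h (i + 1) (by omega)
      · intro h i hi
        cases i with
        | zero => exact hx
        | succ i => exact h i (by omega)
    simp only [this, quenched_path _ ω (fun i => y (i + 1)), zero_add]
    rw [Finset.prod_range_succ', stepLaw_singleton, if_pos hx, one_mul, Finset.mul_sum, ← hx]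
    refine Finset.sum_congr rfl fun e _ => ?_
    split_ifs <;> simp [mul_comm]

theorem quenched_apply_eq_sum (x : Site d) (ω : Env d κ) {A : Set (ℕ → Site d)}
    (hA : MeasurableSet A) :
    quenched x ω A =
      ∑ e : Dir d, ENNReal.ofReal ((ω x).1 e) * quenched (x + e.vec) ω (consPath x ⁻¹' A) := by
  conv_lhs => rw [quenched_eq_sum]
  simp only [Measure.finsetSum_apply, Measure.smul_apply, smul_eq_mul,
    Measure.map_apply (measurable_consPath x) hA]

theorem sum_ofReal_env (ω : Env d κ) (x : Site d) :
    ∑ e : Dir d, ENNReal.ofReal ((ω x).1 e) = 1 := by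
  rw [← ENNReal.ofReal_sum_of_nonneg fun e _ => (ω x).2.1.1 e, (ω x).2.1.2, ENNReal.ofReal_one]

theorem quenched_start_ne (x : Site d) (ω : Env d κ) : quenched x ω {w | w 0 ≠ x} = 0 := by
  have h : MeasurableSet {w : ℕ → Site d | w 0 ≠ x} := measurableSet_eval_mem 0 {x}ᶜ
  rw [quenched_apply_eq_sum x ω h]
  simp

theorem ae_quenched_start (x : Site d) (ω : Env d κ) : ∀ᵐ w ∂quenched x ω, w 0 = x :=
  quenched_start_ne x ω

theorem sum_abs_dir_vec (e : Dir d) : ∑ i, |e.vec i| = 1 := by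
  rw [Finset.sum_eq_single e.1]
  · rcases e with ⟨i, _ | _⟩ <;> simp [Dir.vec]
  · intro i _ hi; simp [Dir.vec, hi]
  · simp

theorem measurableSet_stepAt (n : ℕ) :
    MeasurableSet {w : ℕ → Site d | ∑ i, |w (n + 1) i - w n i| ≤ 1} := by
  have : Measurable fun w : ℕ → Site d => (w (n + 1), w n) :=
    (measurable_pi_apply _).prodMk (measurable_pi_apply _)
  exact this ({p : Site d × Site d | ∑ i, |p.1 i - p.2 i| ≤ 1}).to_countable.measurableSet

theorem measurableSet_step :
    MeasurableSet {w : ℕ → Site d | ∀ n, ∑ i, |w (n + 1) i - w n i| ≤ 1} := by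
  rw [ofPred_forall]
  exact .iInter measurableSet_stepAt

/-- The quenched walk makes nearest-neighbour steps. -/
theorem ae_quenched_step (x : Site d) (ω : Env d κ) :
    ∀ᵐ w ∂quenched x ω, ∀ n, ∑ i, |w (n + 1) i - w n i| ≤ 1 := by
  refine ae_all_iff.2 fun n => ?_
  have hm : ∀ n, MeasurableSet {w : ℕ → Site d | ¬ ∑ i, |w (n + 1) i - w n i| ≤ 1} :=
    fun n => (measurableSet_stepAt n).compl
  induction n generalizing x with
  | zero =>
    rw [ae_iff, quenched_apply_eq_sum x ω (hm 0)]
    refine Finset.sum_eq_zero fun e _ => mul_eq_zero_of_right _ ?_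
    refine measure_mono_null (fun w hw => ?_) (quenched_start_ne (x + e.vec) ω)
    intro h0
    refine hw ?_
    simp [h0, sum_abs_dir_vec]
  | succ n ih =>
    rw [ae_iff, quenched_apply_eq_sum x ω (hm (n + 1))]
    exact Finset.sum_eq_zero fun e _ => mul_eq_zero_of_right _ (ae_iff.1 (ih (x + e.vec)))

theorem measurableSet_firstVisit (z : Site d) (n : ℕ) {A : Set (ℕ → Site d)}
    (hA : MeasurableSet A) : MeasurableSet
      {w : ℕ → Site d | w n = z ∧ (∀ m < n, w m ≠ z) ∧ (fun k => w (n + k)) ∈ A} := by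
  have h1 : MeasurableSet {w : ℕ → Site d | (fun k => w (n + k)) ∈ A} :=
    (measurable_pi_lambda _ fun k => measurable_pi_apply (n + k)) hA
  have h2 : MeasurableSet {w : ℕ → Site d | ∀ m < n, w m ≠ z} := by
    simp only [ofPred_forall]
    exact .iInter fun m => .iInter fun _ => measurableSet_eval_mem m {z}ᶜ
  exact (measurableSet_eval_mem n {z}).inter (h2.inter h1)

/-- The strong Markov property at the first visit to `z`, as an inequality: the probability that
`z` is visited and that the path after the first visit is in `A` is at most `P_{z,ω}[A]`. -/
theorem quenched_firstVisit_le (x z : Site d) (ω : Env d κ) {A : Set (ℕ → Site d)}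
    (hA : MeasurableSet A) :
    quenched x ω {w | ∃ n, w n = z ∧ (∀ m < n, w m ≠ z) ∧ (fun k => w (n + k)) ∈ A} ≤
      quenched z ω A := by
  let V : ℕ → Set (ℕ → Site d) := fun N =>
    {w | ∃ n ≤ N, w n = z ∧ (∀ m < n, w m ≠ z) ∧ (fun k => w (n + k)) ∈ A}
  have hV : ∀ N, MeasurableSet (V N) := by
    intro N
    have : V N = ⋃ n, ⋃ _ : n ≤ N,
        {w | w n = z ∧ (∀ m < n, w m ≠ z) ∧ (fun k => w (n + k)) ∈ A} := by
      ext w; simp only [V, mem_ofPred_eq, mem_iUnion, exists_prop]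
    rw [this]
    exact .iUnion fun n => .iUnion fun _ => measurableSet_firstVisit z n hA
  have key : ∀ N x, quenched x ω (V N) ≤ quenched z ω A := by
    intro N
    have hz : quenched z ω (V N) ≤ quenched z ω A := by
      refine measure_mono_ae ?_
      filter_upwards [ae_quenched_start z ω] with w h0
      rintro ⟨n, -, -, hlt, hn⟩
      obtain rfl : n = 0 := by
        by_contra hc
        exact hlt 0 (Nat.pos_of_ne_zero hc) h0
      simp only [zero_add] at hn
      exact hn
    induction N with
    | zero =>
      intro x
      by_cases hx : x = z
      · rw [hx]; exact hz
      · refine (le_of_eq ?_).trans zero_le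
        refine measure_mono_null (fun w => ?_) (quenched_start_ne x ω)
        rintro ⟨n, hn, hnz, -⟩ h0
        obtain rfl : n = 0 := by omega
        exact hx (h0.symm.trans hnz)
    | succ N ih =>
      intro x
      by_cases hx : x = z
      · rw [hx]; exact hz
      · have hz' : quenched z ω (V N) ≤ quenched z ω A := by
          refine (measure_mono fun w => ?_).trans hz
          rintro ⟨n, hn, h⟩
          exact ⟨n, by omega, h⟩
        rw [quenched_apply_eq_sum x ω (hV _)]
        calc _ ≤ ∑ e : Dir d, ENNReal.ofReal ((ω x).1 e) * quenched z ω A := by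
              refine Finset.sum_le_sum fun e _ => mul_le_mul_right ?_ _
              refine (measure_mono fun w => ?_).trans (ih hz' (x + e.vec))
              rintro ⟨n, hn, hnz, hlt, h⟩
              cases n with
              | zero => exact absurd hnz hx
              | succ n =>
                refine ⟨n, by omega, hnz, fun m hm => hlt (m + 1) (by omega), ?_⟩
                simpa [Nat.add_right_comm n 1] using h
          _ = _ := by rw [← Finset.sum_mul, sum_ofReal_env, one_mul]
  have hU : {w | ∃ n, w n = z ∧ (∀ m < n, w m ≠ z) ∧ (fun k => w (n + k)) ∈ A} = ⋃ N, V N := by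
    ext w
    simp only [mem_ofPred_eq, mem_iUnion, V]
    exact ⟨fun ⟨n, h⟩ => ⟨n, n, le_rfl, h⟩, fun ⟨_, n, _, h⟩ => ⟨n, h⟩⟩
  rw [hU, Monotone.measure_iUnion]
  · exact iSup_le fun N => key N x
  · intro N N' hN w
    rintro ⟨n, hn, h⟩
    exact ⟨n, hn.trans hN, h⟩

/-- The walk leaves every finite set: the probability of staying in it forever is harmonic inside
and zero outside, so, at a point where it is maximal and positive, it has the same value at all
neighbours, hence along a whole line. -/
theorem quenched_forall_mem_eq_zero (hd : 0 < d) (hκ : 0 < κ) (ω : Env d κ) {A : Set (Site d)}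
    (hA : A.Finite) (x : Site d) : quenched x ω {w | ∀ n, w n ∈ A} = 0 := by
  let g : Site d → ENNReal := fun x => quenched x ω {w | ∀ n, w n ∈ A}
  have hm : MeasurableSet {w : ℕ → Site d | ∀ n, w n ∈ A} := by
    rw [ofPred_forall]
    exact .iInter fun n => measurableSet_eval_mem n A
  have hout : ∀ x, x ∉ A → g x = 0 := fun x hx =>
    measure_mono_null (fun w hw (h0 : w 0 = x) => hx (h0 ▸ hw 0)) (quenched_start_ne x ω)
  have hharm : ∀ x, g x ≤ ∑ e : Dir d, ENNReal.ofReal ((ω x).1 e) * g (x + e.vec) := by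
    intro x
    simp only [g]
    rw [quenched_apply_eq_sum x ω hm]
    refine Finset.sum_le_sum fun e _ => mul_le_mul_right (measure_mono fun w hw => ?_) _
    exact fun n => (show ∀ n, consPath x w n ∈ A from hw) (n + 1)
  by_contra hne
  have hxA : x ∈ A := by
    by_contra h
    exact hne (hout x h)
  obtain ⟨z, hz, hmax⟩ := hA.exists_maximalFor g A ⟨x, hxA⟩
  have hmax' : ∀ y, g y ≤ g z := by
    intro y
    by_cases hy : y ∈ A
    · exact (le_total (g y) (g z)).elim id (fun h => hmax hy h)
    · rw [hout y hy]; exact zero_le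
  have hpos : g z ≠ 0 := fun h => hne (le_antisymm (h ▸ hmax' x) zero_le)
  let e : Dir d := (⟨0, hd⟩, true)
  have hstep : ∀ y, g y = g z → g (y + e.vec) = g z := by
    intro y hy
    by_contra hlt
    have hlt : g (y + e.vec) < g z := lt_of_le_of_ne (hmax' _) hlt
    have : g y < g z := by
      calc g y ≤ _ := hharm y
        _ < ∑ e : Dir d, ENNReal.ofReal ((ω y).1 e) * g z := by
          rw [← Finset.add_sum_erase _ _ (Finset.mem_univ e),
            ← Finset.add_sum_erase _ _ (Finset.mem_univ e)]
          have hω : 0 < (ω y).1 e := by have := (ω y).2.2 e; linarith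
          refine ENNReal.add_lt_add_of_lt_of_le ?_ ?_ ?_
          · refine (ENNReal.sum_lt_top.2 fun i _ => ?_).ne
            exact ENNReal.mul_lt_top ENNReal.ofReal_lt_top (measure_lt_top _ _)
          · exact ENNReal.mul_lt_mul_right (by simpa using hω) ENNReal.ofReal_ne_top hlt
          · exact Finset.sum_le_sum fun i _ => mul_le_mul_right (hmax' _) _
        _ = g z := by rw [← Finset.sum_mul, sum_ofReal_env, one_mul]
    exact this.ne hy
  have hline : ∀ n : ℕ, g (z + n • e.vec) = g z := by
    intro n
    induction n with
    | zero => simp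
    | succ n ih => rw [succ_nsmul, ← add_assoc]; exact hstep _ ih
  have hinj : Function.Injective fun n : ℕ => z + n • e.vec := by
    intro m n h
    have := congrFun (add_left_cancel h) e.1
    simpa [Dir.vec, e] using this
  refine Set.infinite_range_of_injective hinj (hA.subset ?_)
  rintro _ ⟨n, rfl⟩
  by_contra h
  exact hpos ((hline n).symm.trans (hout _ h))

theorem stepLaw_translate (ω : Env d κ) (x y z : Site d) :
    stepLaw (fun v => ω (v + z)) x {y} = stepLaw ω (x + z) {y + z} := by
  simp only [stepLaw_singleton]
  refine Finset.sum_congr rfl fun e _ => ?_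
  have : x + z + e.vec = y + z ↔ x + e.vec = y := by
    rw [add_right_comm, add_left_inj]
  simp [this]

/-- Translating the environment amounts to translating the walk. -/
theorem quenched_translate (ω : Env d κ) (z : Site d) :
    quenched 0 (fun v => ω (v + z)) = (quenched z ω).map (fun w n => w n - z) := by
  have hm : Measurable fun (w : ℕ → Site d) n => w n - z :=
    measurable_pi_lambda _ fun n => (measurable_of_countable (· - z)).comp (measurable_pi_apply n)
  have : IsFiniteMeasure ((quenched z ω).map (fun w n => w n - z)) :=
    Measure.isFiniteMeasure_map _ _
  refine ext_of_path fun n y => ?_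
  rw [Measure.map_apply hm (measurableSet_setOf_path y n)]
  have : (fun (w : ℕ → Site d) n => w n - z) ⁻¹' {w | ∀ i ≤ n, w i = y i} =
      {w | ∀ i ≤ n, w i = y i + z} := by
    ext w; simp [sub_eq_iff_eq_add]
  rw [this, quenched_path, quenched_path _ _ fun i => y i + z]
  simp only [stepLaw_translate]
  simp [eq_comm]

end Markov

/-! ### The annealed walk -/

section Annealed

variable {d : ℕ} {κ : ℝ}

theorem annealedProb_eq_lintegral (P : Measure (Env d κ)) [SFinite P] (x : Site d)
    {A : Set (ℕ → Site d)} (hA : MeasurableSet A) : annealedProb P x A = ∫⁻ ω, quenched x ω A ∂P := by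
  exact Measure.compProd_apply (measurable_snd hA)

theorem ae_annealed (P : Measure (Env d κ)) [SFinite P] (x : Site d) {N : Set (ℕ → Site d)}
    (hN : MeasurableSet N) (h : ∀ ω : Env d κ, ∀ᵐ w ∂quenched x ω, w ∈ N) :
    ∀ᵐ p ∂annealed P x, p.2 ∈ N :=
  Measure.ae_compProd_of_ae_ae (measurable_snd hN) (.of_forall h)

/-- Bad behaviour after the first visit to one of finitely many sites: by stationarity each site
costs as much as the origin. -/
theorem annealedProb_firstVisit_le (P : Measure (Env d κ)) [SFinite P] (hP : IsStationary P)
    {E : Set (ℕ → Site d)} (hE : MeasurableSet E) (S : Finset (Site d)) :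
    annealedProb P 0 {w | ∃ z ∈ S, ∃ n, w n = z ∧ (∀ m < n, w m ≠ z) ∧
      (fun k => w (n + k) - z) ∈ E} ≤ S.card * annealedProb P 0 E := by
  have hm : ∀ z : Site d, Measurable fun (w : ℕ → Site d) n => w n - z := fun z =>
    measurable_pi_lambda _ fun n => (measurable_of_countable (· - z)).comp (measurable_pi_apply n)
  have key : ∀ z ∈ S, annealedProb P 0 {w | ∃ n, w n = z ∧ (∀ m < n, w m ≠ z) ∧
      (fun k => w (n + k) - z) ∈ E} ≤ annealedProb P 0 E := by
    intro z _
    have hV : MeasurableSet {w : ℕ → Site d | ∃ n, w n = z ∧ (∀ m < n, w m ≠ z) ∧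
        (fun k => w (n + k) - z) ∈ E} := by
      rw [ofPred_exists]
      exact .iUnion fun n => measurableSet_firstVisit z n (hm z hE)
    have hshift : Measurable fun (ω : Env d κ) x => ω (x + z) :=
      measurable_pi_lambda _ fun x => measurable_pi_apply (x + z)
    have hf : Measurable fun ω : Env d κ => quenched 0 ω E :=
      (Measure.measurable_coe hE).comp (measurable_quenched 0)
    have hq : ∀ ω : Env d κ, quenched 0 ω {w | ∃ n, w n = z ∧ (∀ m < n, w m ≠ z) ∧
        (fun k => w (n + k) - z) ∈ E} ≤ quenched 0 (fun v => ω (v + z)) E := by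
      intro ω
      have h := quenched_firstVisit_le 0 z ω (hm z hE)
      rw [quenched_translate, Measure.map_apply (hm z) hE]
      simpa only [mem_preimage] using h
    calc _ = ∫⁻ ω, quenched 0 ω {w | ∃ n, w n = z ∧ (∀ m < n, w m ≠ z) ∧
            (fun k => w (n + k) - z) ∈ E} ∂P := annealedProb_eq_lintegral P 0 hV
      _ ≤ ∫⁻ ω : Env d κ, quenched 0 (fun v => ω (v + z) : Env d κ) E ∂P := by
          exact lintegral_mono hq
      _ = ∫⁻ ω, quenched 0 ω E ∂(P.map fun ω x => ω (x + z)) :=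
          (lintegral_map hf hshift).symm
      _ = _ := by rw [hP z, annealedProb_eq_lintegral P 0 hE]
  calc _ ≤ annealed P 0 (⋃ z ∈ S, {p | p.2 ∈ {w | ∃ n, w n = z ∧ (∀ m < n, w m ≠ z) ∧
      (fun k => w (n + k) - z) ∈ E}}) := by
        refine measure_mono fun p hp => ?_
        simpa using hp
    _ ≤ ∑ z ∈ S, annealedProb P 0 {w | ∃ n, w n = z ∧ (∀ m < n, w m ≠ z) ∧
      (fun k => w (n + k) - z) ∈ E} := measure_biUnion_finset_le _ _
    _ ≤ ∑ z ∈ S, annealedProb P 0 E := Finset.sum_le_sum key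
    _ = _ := by simp

end Annealed

/-! ### Lattice points in Euclidean space -/

section Lattice

variable {d : ℕ}

@[simp] theorem toSpace_apply (x : Site d) (i : Fin d) : x.toSpace i = x i := rfl

@[simp] theorem toSpace_zero : (0 : Site d).toSpace = 0 := by ext i; simp

theorem toSpace_sub (x y : Site d) : (x - y).toSpace = x.toSpace - y.toSpace := by ext i; simp

theorem norm_le_sum_abs (x : Space d) : ‖x‖ ≤ ∑ i, |x i| := by
  have h : x = ∑ i, EuclideanSpace.single i (x i) := by
    ext j; simp [Finset.sum_apply, Pi.single_apply]
  calc ‖x‖ = ‖∑ i, EuclideanSpace.single i (x i)‖ := by rw [← h]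
    _ ≤ _ := norm_sum_le _ _
    _ = _ := by simp

theorem norm_toSpace_sub_le {x y : Site d} (h : ∑ i, |x i - y i| ≤ 1) :
    ‖x.toSpace - y.toSpace‖ ≤ 1 := by
  refine (norm_le_sum_abs _).trans ?_
  have : ∑ i, |(x.toSpace - y.toSpace) i| = ((∑ i, |x i - y i| : ℤ) : ℝ) := by simp
  rw [this]
  exact_mod_cast h

theorem inner_single_one (x : Space d) (i : Fin d) :
    inner ℝ x (EuclideanSpace.single i 1) = x i := by
  rw [EuclideanSpace.inner_single_right]; simp

/-- The sites all of whose coordinates are at most `n` in absolute value. -/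
def cube (d n : ℕ) : Finset (Site d) :=
  Fintype.piFinset fun _ => Finset.Icc (-(n : ℤ)) n

theorem card_cube (n : ℕ) : (cube d n).card = (2 * n + 1) ^ d := by
  simp only [cube, Fintype.card_piFinset, Int.card_Icc, Finset.prod_const, Finset.card_univ,
    Fintype.card_fin]
  congr 1; omega

theorem mem_cube_of_norm_le {n : ℕ} {x : Site d} (h : ‖x.toSpace‖ ≤ n) : x ∈ cube d n := by
  refine Fintype.mem_piFinset.2 fun i => Finset.mem_Icc.2 (abs_le.1 ?_)
  have := (PiLp.norm_apply_le x.toSpace i).trans h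
  rw [toSpace_apply, Real.norm_eq_abs] at this
  exact_mod_cast this

end Lattice

/-! ### Iterating exits -/

section Iteration

variable {d : ℕ} {κ : ℝ} {P : Measure (Env d κ)}

theorem annealedProb_mono_ae {A B : Set (ℕ → Site d)}
    (h : ∀ᵐ p ∂annealed P 0, p.2 ∈ A → p.2 ∈ B) : annealedProb P 0 A ≤ annealedProb P 0 B :=
  measure_mono_ae h

variable [IsProbabilityMeasure P]

theorem ae_annealed_start : ∀ᵐ p ∂annealed P 0, p.2 0 = 0 :=
  ae_annealed P 0 (measurableSet_eval_mem 0 {0}) (ae_quenched_start 0)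

theorem ae_annealed_step : ∀ᵐ p ∂annealed P 0, ∀ n, ∑ i, |p.2 (n + 1) i - p.2 n i| ≤ 1 :=
  ae_annealed P 0 measurableSet_step (ae_quenched_step 0)

theorem ae_annealed_exit (hd : 0 < d) (hκ : 0 < κ) {A : Set (Site d)} (hA : A.Finite) :
    ∀ᵐ p ∂annealed P 0, ∃ n, p.2 n ∉ A := by
  have hm : MeasurableSet {w : ℕ → Site d | ∃ n, w n ∉ A} := by
    rw [ofPred_exists]
    exact .iUnion fun n => measurableSet_eval_mem n Aᶜ
  refine ae_annealed P 0 hm fun ω => ?_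
  have := quenched_forall_mem_eq_zero hd hκ ω hA 0
  simpa [ae_iff] using this

/-- The paths that, up to some time, stay above level `-lo` in the direction `u` and in
the ball of radius `ρ`, and at that time are at level at least `hi`. -/
def climbs (u : Space d) (lo hi ρ : ℝ) : Set (ℕ → Site d) :=
  {w | ∃ t, hi ≤ inner ℝ (w t).toSpace u ∧
    ∀ s ≤ t, -lo ≤ inner ℝ (w s).toSpace u ∧ ‖(w s).toSpace‖ ≤ ρ}

/-- If, after the first visit to any `z` in the ball of radius `N ρ`, the path leaves `z + Δ`
through `z + F`, then `N` successive exits make it climb `N` times the height of `F`. Each exit is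
counted from the first visit to the site that the previous exits lead to. The time of that exit need
not be later than the time at which the previous one was completed, but this is irrelevant, since
only the levels are added up. -/
theorem mem_climbs_of_exits {u : Space d} {Δ F : Set (Site d)} {lo hi ρ : ℝ} (hlo : 0 ≤ lo)
    (hhi : 0 ≤ hi) (hρ : 0 ≤ ρ)
    (hΔ : ∀ x ∈ Δ, -lo ≤ inner ℝ x.toSpace u ∧ ‖x.toSpace‖ ≤ ρ)
    (hF : ∀ x ∈ F, hi ≤ inner ℝ x.toSpace u ∧ ‖x.toSpace‖ ≤ ρ)
    {w : ℕ → Site d} (h0 : w 0 = 0) (N : ℕ)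
    (h : ∀ z : Site d, ‖z.toSpace‖ ≤ N * ρ → ∀ n, w n = z → (∀ m < n, w m ≠ z) →
      (fun k => w (n + k) - z) ∉ notExitThrough Δ F) :
    ∀ k ≤ N, w ∈ climbs u lo (k * hi) (k * ρ) := by
  intro k
  induction k with
  | zero =>
    intro _
    refine ⟨0, by simp [h0], fun s hs => ?_⟩
    obtain rfl : s = 0 := by omega
    simp [h0, hlo]
  | succ k ih =>
    intro hk
    obtain ⟨t, htu, ht⟩ := ih (by omega)
    -- restart at the first visit `n ≤ t` to the site `w t`
    classical
    have hex : ∃ n, w n = w t := ⟨t, rfl⟩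
    have hnt : Nat.find hex ≤ t := Nat.find_min' hex rfl
    have hn : w (Nat.find hex) = w t := Nat.find_spec hex
    have hmin : ∀ m < Nat.find hex, w m ≠ w t := fun m hm => Nat.find_min hex hm
    generalize Nat.find hex = n at hnt hn hmin
    have hball : ‖(w t).toSpace‖ ≤ N * ρ := by
      refine (ht t le_rfl).2.trans ?_
      gcongr
      omega
    have hE := h (w t) hball n hn hmin
    rw [mem_notExitThrough_iff] at hE
    push Not at hE
    obtain ⟨m, -, hin, hmF⟩ := hE
    have hdecomp : ∀ j, (w (n + j)).toSpace = (w t).toSpace + (w (n + j) - w t).toSpace := by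
      intro j; rw [toSpace_sub]; abel
    have hkhi : 0 ≤ (k : ℝ) * hi := by positivity
    have htn := (ht t le_rfl).2
    refine ⟨n + m, ?_, fun s hs => ?_⟩
    · have := (hF _ hmF).1
      rw [hdecomp, inner_add_left]
      push_cast
      linarith
    · rcases le_or_gt s n with hsn | hsn
      · obtain ⟨h1, h2⟩ := ht s (hsn.trans hnt)
        refine ⟨h1, h2.trans ?_⟩
        gcongr
        omega
      · obtain ⟨j, rfl⟩ := Nat.exists_eq_add_of_le hsn.le
        have hj : -lo ≤ inner ℝ (w (n + j) - w t).toSpace u ∧ ‖(w (n + j) - w t).toSpace‖ ≤ ρ := by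
          rcases (by omega : j ≤ m).lt_or_eq with hjm | rfl
          · exact hΔ _ (hin j hjm)
          · exact ⟨by linarith [(hF _ hmF).1], (hF _ hmF).2⟩
        rw [hdecomp, inner_add_left]
        refine ⟨by linarith [hj.1], (norm_add_le _ _).trans ?_⟩
        push_cast
        linarith [hj.2]

/-- If the walk leaves `Δ M` through `F M` up to exponentially small probability, then, up to
exponentially small probability, it climbs `N` times as high as `F M`: the union bound runs over the
starting sites of the exits, whose number is polynomial in `M`. -/
theorem ExpDecay.climbs (hP : IsStationary P) {u : Space d} {Δ F : ℝ → Set (Site d)} {α β r : ℝ}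
    (hα : 0 ≤ α) (hβ : 0 ≤ β) (hr : 0 ≤ r)
    (hΔ : ∀ᶠ M in atTop, ∀ x ∈ Δ M, -(β * M) ≤ inner ℝ x.toSpace u ∧ ‖x.toSpace‖ ≤ r * M)
    (hF : ∀ᶠ M in atTop, ∀ x ∈ F M, α * M ≤ inner ℝ x.toSpace u ∧ ‖x.toSpace‖ ≤ r * M)
    (hdec : ExpDecay fun M => annealedProb P 0 (notExitThrough (Δ M) (F M))) (N : ℕ) :
    ExpDecay fun M => annealedProb P 0
      (RWRE.climbs u (β * M) (N * (α * M)) (N * (r * M)))ᶜ := by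
  refine hdec.of_eventually_le_pow_mul (C := (2 * (N * r) + 3) ^ d) (n := d) ?_
  filter_upwards [hΔ, hF, eventually_ge_atTop 1] with M hΔ hF hM
  have hM0 : 0 ≤ M := by linarith
  set S := cube d ⌈N * (r * M)⌉₊
  calc _ ≤ annealedProb P 0 {w | ∃ z ∈ S, ∃ n, w n = z ∧ (∀ m < n, w m ≠ z) ∧
        (fun k => w (n + k) - z) ∈ notExitThrough (Δ M) (F M)} := by
        refine annealedProb_mono_ae ?_
        filter_upwards [ae_annealed_start (P := P)] with p h0 hp
        by_contra hc
        refine hp (mem_climbs_of_exits (by positivity) (by positivity) (by positivity) hΔ hF h0 N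
          (fun z hz n hn hmin hmem => hc ?_) N le_rfl)
        exact ⟨z, mem_cube_of_norm_le (hz.trans (Nat.le_ceil _)), n, hn, hmin, hmem⟩
    _ ≤ S.card * annealedProb P 0 (notExitThrough (Δ M) (F M)) :=
        annealedProb_firstVisit_le P hP (measurableSet_notExitThrough _ _) S
    _ ≤ _ := by
        gcongr
        rw [card_cube, ← ENNReal.ofReal_natCast, ← mul_pow]
        refine ENNReal.ofReal_le_ofReal ?_
        push_cast
        refine pow_le_pow_left₀ (by positivity) ?_ d
        have := (Nat.ceil_lt_add_one (by positivity : 0 ≤ N * (r * M))).le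
        linarith

end Iteration

/-! ### The three implications -/

section Implications

variable {d : ℕ} {κ : ℝ} {P : Measure (Env d κ)}

/-- A path that climbs in the direction `w` reaches the upper side of a slab normal to `w` before
the lower one. -/
theorem ExpDecay.slab {w : Space d} (hw : w ≠ 0) {lo hi β α r : ℝ}
    (hlo : β < lo) (hhi : hi ≤ α)
    (h : ExpDecay fun M => annealedProb P 0 (RWRE.climbs w (β * M) (α * M) (r * M))ᶜ) :
    ExpDecay fun M => annealedProb P 0
      {p | timeBelow (‖w‖⁻¹ • w) (-(lo / ‖w‖) * M) p < timeAbove (‖w‖⁻¹ • w) (hi / ‖w‖ * M) p} := by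
  have hw' : 0 < ‖w‖ := norm_pos_iff.2 hw
  refine h.mono ?_
  filter_upwards [eventually_gt_atTop 0] with M hM
  refine measure_mono fun p hp hcl => ?_
  obtain ⟨n, hn, hlt⟩ := timeBelow_lt_timeAbove_iff.1 hp
  obtain ⟨t, ht, hts⟩ := hcl
  have hβ : β * M < lo * M := mul_lt_mul_of_pos_right hlo hM
  have hα : hi * M ≤ α * M := mul_le_mul_of_nonneg_right hhi hM.le
  rcases le_or_gt t n with htn | hnt
  · have := hlt t htn
    rw [real_inner_smul_right, ← div_eq_inv_mul, div_mul_eq_mul_div,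
      div_lt_div_iff_of_pos_right hw'] at this
    linarith
  · rw [real_inner_smul_right, ← div_eq_inv_mul, ← neg_div, div_mul_eq_mul_div,
      div_le_div_iff_of_pos_right hw'] at hn
    linarith [(hts n hnt.le).1]

variable [IsProbabilityMeasure P]

/-- A path that leaves `A` does so through the boundary. -/
theorem mem_boundary_of_exit {A : Set (Site d)} {w : ℕ → Site d} (h0 : w 0 ∈ A)
    (hstep : ∀ n, ∑ i, |w (n + 1) i - w n i| ≤ 1) {n : ℕ} (hn : w n ∉ A)
    (hlt : ∀ m < n, w m ∈ A) : w n ∈ boundary A := by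
  cases n with
  | zero => exact absurd h0 hn
  | succ n => exact ⟨hn, w n, hlt n (by omega), hstep n⟩

theorem norm_le_of_mem_boundary {A : Set (Site d)} {ρ : ℝ} (hA : ∀ x ∈ A, ‖x.toSpace‖ ≤ ρ)
    {x : Site d} (hx : x ∈ boundary A) : ‖x.toSpace‖ ≤ ρ + 1 := by
  obtain ⟨-, y, hy, hxy⟩ := hx
  have h1 := norm_toSpace_sub_le hxy
  have h2 := norm_le_norm_add_norm_sub' x.toSpace y.toSpace
  linarith [hA y hy]

/-- If vectors `l i` span the space, a set on which all `⟪x, l i⟫` are bounded is bounded. -/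
theorem exists_norm_le_of_span_eq_top {ι : Type*} {l : ι → Space d}
    (hl : Submodule.span ℝ (range l) = ⊤) {Q : Set (Space d)}
    (hQ : ∀ i, ∃ C : ℝ, ∀ x ∈ Q, |inner ℝ x (l i)| ≤ C) : ∃ C : ℝ, 0 < C ∧ ∀ x ∈ Q, ‖x‖ ≤ C := by
  have key : ∀ v ∈ Submodule.span ℝ (range l), ∃ C : ℝ, ∀ x ∈ Q, |inner ℝ x v| ≤ C := by
    intro v hv
    induction hv using Submodule.span_induction with
    | mem v hv => obtain ⟨i, rfl⟩ := hv; exact hQ i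
    | zero => exact ⟨0, by simp⟩
    | add v v' _ _ h h' =>
      obtain ⟨C, h⟩ := h
      obtain ⟨C', h'⟩ := h'
      refine ⟨C + C', fun x hx => ?_⟩
      rw [inner_add_right]
      exact (abs_add_le _ _).trans (add_le_add (h x hx) (h' x hx))
    | smul a v _ h =>
      obtain ⟨C, h⟩ := h
      refine ⟨|a| * C, fun x hx => ?_⟩
      rw [inner_smul_right, abs_mul]
      exact mul_le_mul_of_nonneg_left (h x hx) (abs_nonneg a)
  choose C hC using fun i : Fin d => key (EuclideanSpace.single i 1) (hl ▸ Submodule.mem_top)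
  refine ⟨max 1 (∑ i, C i), by positivity, fun x hx => le_max_of_le_right ?_⟩
  refine (norm_le_sum_abs x).trans (Finset.sum_le_sum fun i _ => ?_)
  simpa only [inner_single_one] using hC i x hx

theorem finite_of_norm_le {A : Set (Site d)} {ρ : ℝ} (hA : ∀ x ∈ A, ‖x.toSpace‖ ≤ ρ) :
    A.Finite :=
  (cube d ⌈ρ⌉₊).finite_toSet.subset fun x hx =>
    mem_cube_of_norm_le ((hA x hx).trans (Nat.le_ceil ρ))

/-- The exit sets are the dilated regions behind the front face of slab `0` and in front of the back
faces of all slabs. A path that leaves every slab through its front face cannot leave such a region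
through a back face, because the region lies behind the other front faces. -/
theorem HasSlabs.hasExitSets (hd : 0 < d) (hκ : 0 < κ) {l₀ : Space d} (h : HasSlabs P l₀) :
    HasExitSets P l₀ := by
  obtain ⟨k, l, a, b, rfl, h⟩ := h
  have ha0 := h.a_zero
  obtain ⟨r, hr, hbound⟩ := exists_norm_le_of_span_eq_top h.span_eq_top
    (Q := {x : Space d | inner ℝ x (l 0) ∈ Set.Icc (-b 0) 1 ∧ ∀ i ≠ 0, -b i ≤ inner ℝ x (l i)})
    (by
      intro i
      refine ⟨max (b i) (a i), fun x hx => abs_le.2 ?_⟩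
      have h1 : -b i ≤ inner ℝ x (l i) ∧ inner ℝ x (l i) ≤ a i := by
        rcases eq_or_ne i 0 with rfl | hi
        · exact ⟨hx.1.1, ha0 ▸ hx.1.2⟩
        · exact ⟨hx.2 i hi, (h.subset_slabs hx i hi).le⟩
      exact ⟨by linarith [le_max_left (b i) (a i)], h1.2.trans (le_max_right _ _)⟩)
  let Δ : ℝ → Set (Site d) := fun M => {x | (∀ i, -(b i * M) < inner ℝ x.toSpace (l i)) ∧
    inner ℝ x.toSpace (l 0) < M}
  -- `Δ M` lies in the slab region dilated by `M`
  have hmem : ∀ M > 0, ∀ x ∈ Δ M, M⁻¹ • x.toSpace ∈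
      {x : Space d | inner ℝ x (l 0) ∈ Set.Icc (-b 0) 1 ∧ ∀ i ≠ 0, -b i ≤ inner ℝ x (l i)} := by
    intro M hM x hx
    have h1 : ∀ i, -b i ≤ inner ℝ (M⁻¹ • x.toSpace) (l i) := by
      intro i
      rw [real_inner_smul_left, ← div_eq_inv_mul, le_div_iff₀ hM]
      linarith [hx.1 i]
    refine ⟨⟨h1 0, ?_⟩, fun i _ => h1 i⟩
    rw [real_inner_smul_left, ← div_eq_inv_mul, div_le_one hM]
    exact hx.2.le
  have hnorm : ∀ M > 0, ∀ x ∈ Δ M, ‖x.toSpace‖ ≤ r * M := by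
    intro M hM x hx
    have := hbound _ (hmem M hM x hx)
    rwa [norm_smul, norm_inv, Real.norm_of_nonneg hM.le, ← div_eq_inv_mul, div_le_iff₀ hM] at this
  have hzero : ∀ M > 0, (0 : Site d) ∈ Δ M := by
    intro M hM
    refine ⟨fun i => ?_, by simpa using hM⟩
    have := mul_pos (h.b_pos i) hM
    simpa using this
  refine ⟨b 0, r, h.b_pos 0, hr, Δ, ?_, ?_⟩
  · filter_upwards [eventually_gt_atTop 0] with M hM
    refine ⟨finite_of_norm_le (hnorm M hM), hzero M hM, fun x hx => ⟨?_, hnorm M hM x hx⟩⟩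
    have := (hx.1 0).le
    rwa [← neg_mul] at this
  · refine (ExpDecay.sum Finset.univ fun i _ => h.decay i).mono ?_
    filter_upwards [eventually_gt_atTop 0] with M hM
    refine le_trans ?_ (measure_biUnion_finset_le _ _)
    refine measure_mono_ae ?_
    filter_upwards [ae_annealed_start (P := P), ae_annealed_step (P := P),
      ae_annealed_exit (P := P) hd hκ (finite_of_norm_le (hnorm M hM))] with p h0 hstep hexit hp
    by_contra hc
    have hc' : ∀ i, ¬ timeBelow (l i) (-b i * M) p.2 < timeAbove (l i) (a i * M) p.2 :=
      fun i hi => hc (mem_biUnion (Finset.mem_univ i) hi)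
    have hexit' : ∃ n, p.2 n ∉ Δ M ∧ ∀ m < n, p.2 m ∈ Δ M := by
      classical
      exact ⟨Nat.find hexit, Nat.find_spec hexit, fun m hm => not_not.1 (Nat.find_min hexit hm)⟩
    obtain ⟨n, hn, hlt⟩ := hexit'
    refine mem_notExitThrough_iff.1 hp n hn hlt
      ⟨mem_boundary_of_exit (by rw [h0]; exact hzero M hM) hstep hn hlt, ?_⟩
    by_contra hlow
    -- the exit site is below the front face, hence behind some slab `i`, which is then left through
    -- the wrong side
    have : ∃ i, inner ℝ (p.2 n).toSpace (l i) ≤ -(b i * M) := by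
      by_contra! hall
      exact hn ⟨hall, not_le.1 hlow⟩
    obtain ⟨i, hi⟩ := this
    refine hc' i (timeBelow_lt_timeAbove_iff.2 ⟨n, by rwa [neg_mul], fun m hm => ?_⟩)
    rcases hm.lt_or_eq with hm | rfl
    · have hx := hlt m hm
      rcases eq_or_ne i 0 with rfl | hi0
      · rw [ha0, one_mul]; exact hx.2
      · have := h.subset_slabs (hmem M hM _ hx) i hi0
        change inner ℝ (M⁻¹ • (p.2 m).toSpace) (l i) < a i at this
        rwa [real_inner_smul_left, ← div_eq_inv_mul, div_lt_iff₀ hM] at this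
    · have := mul_pos (h.b_pos i) hM
      have := mul_pos (h.a_pos i) hM
      linarith

variable {R : Space d ≃ₗᵢ[ℝ] Space d} {l₀ : Space d}

theorem mem_box_iff {L L' : ℝ} {x : Site d} :
    x ∈ box R L L' ↔ ∀ i : Fin d, |R.symm x.toSpace i| < if (i : ℕ) = 0 then L else L' := by
  constructor
  · rintro ⟨z, hz, hx⟩
    rw [hx, R.symm_apply_apply]
    exact hz
  · exact fun h => ⟨_, h, by simp⟩

theorem inner_map_single (x : Space d) (i : Fin d) :
    inner ℝ x (R (EuclideanSpace.single i 1)) = R.symm x i := by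
  rw [← R.symm.inner_map_map, R.symm_apply_apply, inner_single_one]

/-- Climbing `N` times through `Δ (M / N)` reaches level `M` without going below `-bM/N`, which is
above the back face of the box as soon as `N > b`. -/
theorem HasExitSets.hasBoxExit (hd : 0 < d) (hP : IsStationary P)
    (hR : R (EuclideanSpace.single ⟨0, hd⟩ 1) = l₀) (h : HasExitSets P l₀) :
    HasBoxExit P l₀ R := by
  obtain ⟨b, r, hb, hr, Δ, hΔ, hdec⟩ := h
  obtain ⟨N, hN⟩ := exists_nat_gt b
  have hN0 : (0 : ℝ) < N := hb.trans hN
  have hinner : ∀ x : Space d, inner ℝ x l₀ = R.symm x ⟨0, hd⟩ := fun x => by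
    rw [← hR, inner_map_single]
  -- the boundary reaches one lattice step beyond `Δ M`, and `r * M + 1 ≤ (r + 1) * M` for `M ≥ 1`
  have hclimb := ExpDecay.climbs hP (u := l₀) (α := 1) (β := b) (r := r + 1) zero_le_one hb.le
    (by positivity) (Δ := Δ) (F := fun M => posBoundary (Δ M) l₀ M)
    (by
      filter_upwards [hΔ, eventually_ge_atTop 1] with M hM h1 x hx
      have := hM.2.2 hx
      refine ⟨by rw [← neg_mul]; exact this.1, (show ‖x.toSpace‖ ≤ r * M from this.2).trans ?_⟩
      linarith)
    (by
      filter_upwards [hΔ, eventually_ge_atTop 1] with M hM h1 x hx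
      refine ⟨by rw [one_mul]; exact hx.2, ?_⟩
      have := norm_le_of_mem_boundary (fun y hy => (hM.2.2 hy).2) hx.1
      linarith) hdec N
  refine ⟨r + 2, by positivity, (hclimb.comp_mul (inv_pos.2 hN0)).mono ?_⟩
  filter_upwards [eventually_gt_atTop 0] with M hM
  refine annealedProb_mono_ae ?_
  filter_upwards [ae_annealed_start (P := P), ae_annealed_step (P := P)] with p h0 hstep hp hcl
  obtain ⟨t, ht, hts⟩ := hcl
  have e1 : (N : ℝ) * (1 * ((N : ℝ)⁻¹ * M)) = M := by field_simp
  have e2 : (N : ℝ) * ((r + 1) * ((N : ℝ)⁻¹ * M)) = (r + 1) * M := by field_simp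
  have e3 : b * ((N : ℝ)⁻¹ * M) < M := by
    have : b * ((N : ℝ)⁻¹ * M) = b / N * M := by field_simp
    rw [this]
    exact mul_lt_of_lt_one_left hM ((div_lt_one hN0).2 hN)
  rw [e1] at ht
  rw [e2] at hts
  set B := box R M ((r + 2) * M)
  have hfront : ∀ s ≤ t, p.2 s ∉ B → M ≤ inner ℝ (p.2 s).toSpace l₀ := by
    intro s hs hB
    by_contra! hc
    refine hB (mem_box_iff.2 fun i => ?_)
    obtain ⟨h1, h2⟩ := hts s hs
    split_ifs with hi
    · obtain rfl : i = ⟨0, hd⟩ := Fin.ext hi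
      rw [← hinner]
      exact abs_lt.2 ⟨by linarith, hc⟩
    · have := PiLp.norm_apply_le (R.symm (p.2 s).toSpace) i
      rw [R.symm.norm_map, Real.norm_eq_abs] at this
      have : |R.symm (p.2 s).toSpace i| ≤ (r + 1) * M := this.trans h2
      linarith
  have hzero : (0 : Site d) ∈ B := by
    refine mem_box_iff.2 fun i => ?_
    have : 0 < (r + 2) * M := by positivity
    split_ifs <;> simpa
  have htB : p.2 t ∉ B := by
    intro hB
    have := mem_box_iff.1 hB ⟨0, hd⟩
    rw [if_pos rfl, ← hinner] at this
    exact (lt_of_abs_lt this).not_ge ht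
  have hexit : ∃ n ≤ t, p.2 n ∉ B ∧ ∀ m < n, p.2 m ∈ B := by
    classical
    have hex : ∃ n, p.2 n ∉ B := ⟨t, htB⟩
    exact ⟨Nat.find hex, Nat.find_min' hex htB, Nat.find_spec hex,
      fun m hm => not_not.1 (Nat.find_min hex hm)⟩
  obtain ⟨n, hnt, hn, hlt⟩ := hexit
  exact mem_notExitThrough_iff.1 hp n hn hlt
    ⟨mem_boundary_of_exit (by rw [h0]; exact hzero) hstep hn hlt, hfront n hnt hn⟩

/-- The slabs are normal to `l₀` and to the vectors `l₀ ± ε R(e_i)`. For small `ε` each exit from the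
box gains `M / 2` in such a direction and never loses more than `3M / 2`, so that iteration gives
slabs whose front sides are as far away as the inclusion of regions requires. -/
theorem HasBoxExit.hasSlabs (hd : 0 < d) (hP : IsStationary P) (hl₀ : ‖l₀‖ = 1)
    (hR : R (EuclideanSpace.single ⟨0, hd⟩ 1) = l₀) (h : HasBoxExit P l₀ R) :
    HasSlabs P l₀ := by
  obtain ⟨r, hr, hdec⟩ := h
  -- small enough for `ε` times a lateral coordinate of a boundary site to be at most `M / 2`
  let ε : ℝ := 1 / (2 * (r + 2))
  have hε : 0 < ε := by positivity
  have hε1 : ε * (r + 2) = 1 / 2 := by simp only [ε]; field_simp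
  let sgn : Bool → ℝ := fun s => if s then 1 else -1
  have hsgn : ∀ s, |sgn s| = 1 := by rintro (_ | _) <;> simp [sgn]
  let v : Dir d → Space d := fun e => l₀ + (sgn e.2 * ε) • R (EuclideanSpace.single e.1 1)
  have hinner0 : ∀ x : Space d, inner ℝ x l₀ = R.symm x ⟨0, hd⟩ := fun x => by
    rw [← hR, inner_map_single]
  have hinner : ∀ (x : Space d) e,
      inner ℝ x (v e) = inner ℝ x l₀ + sgn e.2 * ε * R.symm x e.1 := fun x e => by
    simp only [v, inner_add_right, inner_smul_right, inner_map_single]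
  have hbox : ∀ M > 0, ∀ x ∈ box R M (r * M), ∀ i, |R.symm x.toSpace i| ≤ (r + 1) * M := by
    intro M hM x hx i
    have := mem_box_iff.1 hx i
    have : 0 < r * M := by positivity
    split_ifs at * <;> linarith
  have hbdry : ∀ M ≥ 1, ∀ x ∈ boundary (box R M (r * M)), ∀ i,
      |R.symm x.toSpace i| ≤ (r + 2) * M := by
    rintro M hM x ⟨-, y, hy, hxy⟩ i
    have h1 := norm_toSpace_sub_le hxy
    have h2 := PiLp.norm_apply_le (R.symm (x.toSpace - y.toSpace)) i
    rw [R.symm.norm_map, Real.norm_eq_abs, map_sub, PiLp.sub_apply] at h2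
    have h3 := hbox M (by linarith) y hy i
    have h4 := abs_sub_abs_le_abs_sub (R.symm x.toSpace i) (R.symm y.toSpace i)
    linarith
  have hpert : ∀ (t : ℝ) (e : Dir d) (M : ℝ), |t| ≤ (r + 2) * M → |sgn e.2 * ε * t| ≤ M / 2 := by
    intro t e M ht
    rw [abs_mul, abs_mul, hsgn, abs_of_pos hε, one_mul]
    calc ε * |t| ≤ ε * ((r + 2) * M) := by gcongr
      _ = M / 2 := by rw [← mul_assoc, hε1]; ring
  have hρ : 0 ≤ (d : ℝ) * (r + 2) := by positivity
  have hnorm : ∀ (M : ℝ) (x : Site d), (∀ i, |R.symm x.toSpace i| ≤ (r + 2) * M) →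
      ‖x.toSpace‖ ≤ d * (r + 2) * M := by
    intro M x hx
    rw [← R.symm.norm_map]
    refine (norm_le_sum_abs _).trans ((Finset.sum_le_sum fun i _ => hx i).trans ?_)
    simp [mul_assoc]
  have hlarge : ∀ M > 0, (r + 1) * M ≤ (r + 2) * M := fun M hM => by linarith
  have hclimb0 := hdec.climbs hP (u := l₀) (α := 1) (β := 1) (r := d * (r + 2)) zero_le_one
    zero_le_one hρ (by
      filter_upwards [eventually_gt_atTop 0] with M hM x hx
      refine ⟨?_, hnorm M x fun i => (hbox M hM x hx i).trans (hlarge M hM)⟩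
      have := mem_box_iff.1 hx ⟨0, hd⟩
      rw [if_pos rfl, ← hinner0] at this
      linarith [neg_lt_of_abs_lt this])
    (by
      filter_upwards [eventually_ge_atTop 1] with M hM x hx
      exact ⟨by rw [one_mul]; exact hx.2, hnorm M x (hbdry M hM x hx.1)⟩) 1
  -- ten exits gain `5M`: the front sides at `5` have to be beyond the level `4` that the back sides
  -- at `-2` imply
  have hclimb : ∀ e, _ := fun e => hdec.climbs hP (u := v e) (α := 1 / 2) (β := 3 / 2)
    (r := d * (r + 2)) (by norm_num) (by norm_num) hρ (by
      filter_upwards [eventually_gt_atTop 0] with M hM x hx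
      have hx' := fun i => (hbox M hM x hx i).trans (hlarge M hM)
      refine ⟨?_, hnorm M x hx'⟩
      have h1 := mem_box_iff.1 hx ⟨0, hd⟩
      rw [if_pos rfl, ← hinner0] at h1
      rw [hinner]
      linarith [neg_lt_of_abs_lt h1, neg_le_of_abs_le (hpert _ e M (hx' e.1))])
    (by
      filter_upwards [eventually_ge_atTop 1] with M hM x hx
      have hx' := hbdry M hM x hx.1
      refine ⟨?_, hnorm M x hx'⟩
      have h1 : M ≤ inner ℝ x.toSpace l₀ := hx.2
      rw [hinner]
      linarith [neg_le_of_abs_le (hpert _ e M (hx' e.1))]) 10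
  -- `⟪l₀, v e⟫` is at least `1 / 2`
  have hv : ∀ e, v e ≠ 0 := by
    intro e he
    have h1 := hinner l₀ e
    rw [he, inner_zero_right, real_inner_self_eq_norm_sq, hl₀] at h1
    have h2 := PiLp.norm_apply_le (R.symm l₀) e.1
    rw [R.symm.norm_map, Real.norm_eq_abs, hl₀] at h2
    have h3 := neg_le_of_abs_le (hpert _ e 1 (h2.trans (by linarith)))
    linarith
  let φ : Dir d ≃ Fin (Fintype.card (Dir d)) := Fintype.equivFin _
  refine ⟨Fintype.card (Dir d), Fin.cons l₀ fun i => ‖v (φ.symm i)‖⁻¹ • v (φ.symm i),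
    Fin.cons 1 fun i => 5 / ‖v (φ.symm i)‖, Fin.cons 2 fun i => 2 / ‖v (φ.symm i)‖, rfl, ?_⟩
  have hvpos : ∀ e, 0 < ‖v e‖ := fun e => norm_pos_iff.2 (hv e)
  refine ⟨?_, rfl, ?_, ?_, ?_, ?_, ?_⟩
  · refine Fin.cases hl₀ fun i => ?_
    simp [norm_smul, (hvpos (φ.symm i)).ne']
  · refine Fin.cases one_pos fun i => ?_
    exact div_pos (by norm_num) (hvpos _)
  · refine Fin.cases two_pos fun i => ?_
    exact div_pos (by norm_num) (hvpos _)
  · set W := Submodule.span ℝ (range (Fin.cons l₀ fun i => ‖v (φ.symm i)‖⁻¹ • v (φ.symm i) :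
      Fin (Fintype.card (Dir d) + 1) → Space d))
    have h0 : l₀ ∈ W := Submodule.subset_span ⟨0, rfl⟩
    have h1 : ∀ e, v e ∈ W := by
      intro e
      have : ‖v e‖⁻¹ • v e ∈ W := Submodule.subset_span ⟨(φ e).succ, by simp⟩
      rwa [Submodule.smul_mem_iff _ (inv_ne_zero (hvpos e).ne')] at this
    have h2 : ∀ i, R (EuclideanSpace.single i 1) ∈ W := by
      intro i
      have := W.sub_mem (h1 (i, true)) h0
      simp only [v, add_sub_cancel_left, sgn, if_true, one_mul] at this
      rwa [Submodule.smul_mem_iff _ hε.ne'] at this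
    refine eq_top_iff.2 fun x _ => ?_
    have hx : x = ∑ i, R.symm x i • R (EuclideanSpace.single i 1) := by
      apply R.symm.injective
      ext j
      simp [Finset.sum_apply, Pi.single_apply]
    rw [hx]
    exact W.sum_mem fun i _ => W.smul_mem _ (h2 i)
  · rintro x ⟨⟨-, hx0⟩, hx⟩
    have hx' : ∀ e, -2 ≤ inner ℝ x (v e) := by
      intro e
      have := hx (φ e).succ (Fin.succ_ne_zero _)
      simp only [Fin.cons_succ, Equiv.symm_apply_apply] at this
      rw [real_inner_smul_right, ← div_eq_inv_mul, ← neg_div,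
        div_le_div_iff_of_pos_right (hvpos e)] at this
      exact this
    refine Fin.cases (fun h => absurd rfl h) fun i _ => ?_
    simp only [Fin.cons_succ, Fin.cons_zero] at hx0 ⊢
    rw [real_inner_smul_right, ← div_eq_inv_mul, div_lt_div_iff_of_pos_right (hvpos _)]
    -- the bound from below for the opposite sign bounds the perturbation from above
    have h1 := hx' ((φ.symm i).1, !(φ.symm i).2)
    rw [hinner] at h1 ⊢
    have h2 : sgn (!(φ.symm i).2) = -sgn (φ.symm i).2 := by
      cases (φ.symm i).2 <;> simp [sgn]
    simp only [h2] at h1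
    linarith
  · refine Fin.cases ?_ fun i => ?_
    · have := ExpDecay.slab (P := P) (w := l₀) (lo := 2) (hi := 1) (β := 1) (α := 1)
        (r := d * (r + 2)) (by rw [← norm_ne_zero_iff, hl₀]; exact one_ne_zero) (by norm_num) le_rfl
        (by simpa using hclimb0)
      simpa [hl₀] using this
    · have h1 := hclimb (φ.symm i)
      simp only [Nat.cast_ofNat, ← mul_assoc] at h1
      exact ExpDecay.slab (hv _) (by norm_num) (by norm_num) h1

end Implications
end RWRE

end

theorem mainTheorem9 (d : ℕ) (hd : 2 ≤ d) (κ : ℝ) (hκ : 0 < κ) (hκ' : κ ≤ 1 / (4 * (d : ℝ)))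
    (P : Measure (RWRE.Env d κ)) [IsProbabilityMeasure P] (hP : RWRE.IsStationary P)
    (l₀ : RWRE.Space d) (hl₀ : ‖l₀‖ = 1) (R : RWRE.Space d ≃ₗᵢ[ℝ] RWRE.Space d)
    (hR : R (EuclideanSpace.single ⟨0, by omega⟩ 1) = l₀) :
    List.TFAE [RWRE.HasSlabs P l₀, RWRE.HasExitSets P l₀, RWRE.HasBoxExit P l₀ R] := by
  have hd0 : 0 < d := by omega
  tfae_have 1 → 2 := fun h => h.hasExitSets hd0 hκ
  tfae_have 2 → 3 := fun h => h.hasBoxExit hd0 hP hR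
  tfae_have 3 → 1 := fun h => h.hasSlabs hd0 hP hl₀ hR
  tfae_finish
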